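/- Setting. A correlation is a joint probability distribution $P=[P(x,y)]$, viewed as a nonnegative matrix with entries summing to $1$. A density operator $\rho$ on $\mathbb{C}^a\otimes\mathbb{C}^b$ *generates* an $n\times n$ correlation $P$ without noise, written $\rho\xrightarrow{0}P$, if there are POVMs $\{E_x\}_{x=1}^n$ on $\mathbb{C}^a$ and $\{F_y\}_{y=1}^n$ on $\mathbb{C}^b$ with $P(x,y)=\operatorname{tr}((E_x\otimes F_y)\rho)$ for all $x,y$; its size is half the total number of qubits, $\operatorname{size}(\rho)=\frac12(\lceil\log_2 a\rceil+\lceil\log_2 b\rceil)$. A correlation $P'$ on $[k]\times[l]$, of size $\frac12(\lceil\log_2 k\rceil+\lceil\log_2 l\rceil)$, generates $P$ classically if $P$ arises from $P'$ by local stochastic maps on the two sides; $\mathrm{R}(P)$ is the least size of a correlation that generates $P$ classically. The noiseless quantum advantage is $\mathcal{S}_0(P)=\mathrm{R}(P)/\inf\{\operatorname{size}(\rho):\rho\xrightarrow{0}P\}$ (with $0/0=0$ for product distributions). For a nonnegative matrix $M$, $\operatorname{rank}_+(M)$ is the least $r$ such that $M$ is a sum of $r$ nonnegative rank-one matrices,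 and $\operatorname{rank}_{\mathrm{psd}}(M)$ is the least $r$ such that $M(x,y)=\operatorname{tr}(C_xD_y)$ for some positive semidefinite $C_x,D_y\in\mathbb{C}^{r\times r}$. For $m\ge 2$ distinct reals $\alpha_1,\dots,\alpha_m$ let $\mathrm{EDM}_\alpha(x,y)=(\alpha_x-\alpha_y)^2/\sum_{i,j}(\alpha_i-\alpha_j)^2$. Theorem. Let $|\psi\rangle\in\mathbb{C}^a\otimes\mathbb{C}^b$ be an entangled (i.e. non-product) unit vector. Then there is a family of correlations $\{P_m\}_{m\ge 1}$, $P_m$ of size $(m+1)\times(m+1)$, such that $|\psi\rangle\langle\psi|\xrightarrow{0}P_m$ for all $m\ge 1$ and $\lim_{m\to\infty}\mathcal{S}_0(P_m)=\infty$. Moreover, the family can be chosen so that for some $p\in(0,1]$ independent of $m$ and every $m\ge 2$, $$P_m=\begin{pmatrix} p\,\mathrm{EDM}'_m & 0\\ 0 & 1-p\end{pmatrix},\qquad \mathrm{EDM}'_m=L_m\,\mathrm{EDM}_{\alpha^{(m)}}\,R_m,$$ where $\alpha^{(m)}$ consists of $m$ distinct reals, $L_m,R_m$ are diagonal matrices with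 positive diagonal entries, and both $M=\mathrm{EDM}_{\alpha^{(m)}}$ and $M=\mathrm{EDM}'_m$ satisfy $\operatorname{rank}_{\mathrm{psd}}(M)=2$ and $\operatorname{rank}_+(M)\ge 2\sqrt m-2$. -/

import Mathlib

open Filter Topology
open scoped Matrix Kronecker ENNReal ComplexOrder

namespace CorrGen

noncomputable section

/-- A classical correlation: a joint probability distribution written as a matrix. -/
structure IsCorrelation {m n : ℕ} (P : Matrix (Fin m) (Fin n) ℝ) : Prop where
  nonneg : ∀ x y, 0 ≤ P x y
  sum_eq_one : ∑ x, ∑ y, P x y = 1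

/-- The size of a shared resource whose two parts take `k` and `l` values (respectively, have
dimensions `k` and `l`): half of the total number `⌈log₂ k⌉ + ⌈log₂ l⌉` of bits (qubits). -/
def size (k l : ℕ) : ℝ≥0∞ := ((Nat.clog 2 k + Nat.clog 2 l : ℕ) : ℝ≥0∞) / 2

/-! ### Classical protocols -/

/-- A classical channel: `A x i` is the probability of the output `x` on the input `i`. -/
structure IsChannel {n k : ℕ} (A : Matrix (Fin n) (Fin k) ℝ) : Prop where
  nonneg : ∀ x i, 0 ≤ A x i
  sum_eq_one : ∀ i, ∑ x, A x i = 1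

/-- The seed correlation `Q` yields `P` by local classical operations, without communication. -/
def ClassicallyGenerates {k l n : ℕ} (Q : Matrix (Fin k) (Fin l) ℝ)
    (P : Matrix (Fin n) (Fin n) ℝ) : Prop :=
  ∃ (A : Matrix (Fin n) (Fin k) ℝ) (B : Matrix (Fin n) (Fin l) ℝ),
    IsChannel A ∧ IsChannel B ∧ ∀ x y, P x y = ∑ i, ∑ j, A x i * B y j * Q i j

/-- The classical correlation complexity `R(P)`: the least size of a seed correlation that
generates `P`. -/
def classicalCost {n : ℕ} (P : Matrix (Fin n) (Fin n) ℝ) : ℝ≥0∞ :=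
  ⨅ (k : ℕ) (l : ℕ) (Q : Matrix (Fin k) (Fin l) ℝ)
    (_ : IsCorrelation Q ∧ ClassicallyGenerates Q P), size k l

/-! ### Quantum protocols -/

/-- Operators on `ℂ^a ⊗ ℂ^b`. -/
abbrev BiMatrix (a b : ℕ) : Type := Matrix (Fin a × Fin b) (Fin a × Fin b) ℂ

/-- Density operators. -/
structure IsState {a b : ℕ} (ρ : BiMatrix a b) : Prop where
  posSemidef : ρ.PosSemidef
  trace_eq_one : ρ.trace = 1

/-- The partial trace over the first factor. -/
def traceLeft {a b : ℕ} (ρ : BiMatrix a b) : Matrix (Fin b) (Fin b) ℂ :=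
  Matrix.of fun j j' => ∑ i, ρ (i, j) (i, j')

/-- The partial trace over the second factor. -/
def traceRight {a b : ℕ} (ρ : BiMatrix a b) : Matrix (Fin a) (Fin a) ℂ :=
  Matrix.of fun i i' => ∑ j, ρ (i, j) (i', j)

/-- `𝓔_lam ⊗ id`, where `𝓔_lam(σ) = (1 - lam) σ + lam tr(σ) I / d` is the depolarizing channel. -/
def noiseLeft {a b : ℕ} (lam : ℝ) (ρ : BiMatrix a b) : BiMatrix a b :=
  ((1 - lam : ℝ) : ℂ) • ρ
    + ((lam / a : ℝ) : ℂ) • ((1 : Matrix (Fin a) (Fin a) ℂ) ⊗ₖ traceLeft ρ)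

/-- `id ⊗ 𝓔_lam`. -/
def noiseRight {a b : ℕ} (lam : ℝ) (ρ : BiMatrix a b) : BiMatrix a b :=
  ((1 - lam : ℝ) : ℂ) • ρ
    + ((lam / b : ℝ) : ℂ) • (traceRight ρ ⊗ₖ (1 : Matrix (Fin b) (Fin b) ℂ))

/-- The noise `𝓔_lam ⊗ 𝓔_lam`. -/
def noise {a b : ℕ} (lam : ℝ) (ρ : BiMatrix a b) : BiMatrix a b :=
  noiseLeft lam (noiseRight lam ρ)

/-- A positive operator-valued measurement with `n` outcomes on `ℂ^d`. -/
structure IsPOVM {n d : ℕ} (E : Fin n → Matrix (Fin d) (Fin d) ℂ) : Prop where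
  posSemidef : ∀ x, (E x).PosSemidef
  sum_eq_one : ∑ x, E x = 1

/-- `ρ` generates `P` under noise of strength `lam`: local measurements of
`(𝓔_lam ⊗ 𝓔_lam)(ρ)` have the joint outcome distribution `P`. -/
def Generates {a b n : ℕ} (lam : ℝ) (ρ : BiMatrix a b) (P : Matrix (Fin n) (Fin n) ℝ) : Prop :=
  ∃ (E : Fin n → Matrix (Fin a) (Fin a) ℂ) (F : Fin n → Matrix (Fin b) (Fin b) ℂ),
    IsPOVM E ∧ IsPOVM F ∧ ∀ x y, (P x y : ℂ) = ((E x ⊗ₖ F y) * noise lam ρ).trace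

/-- The least size of a seed state that generates `P` under noise of strength `lam`
(`∞` if there is none). -/
def quantumCost {n : ℕ} (lam : ℝ) (P : Matrix (Fin n) (Fin n) ℝ) : ℝ≥0∞ :=
  ⨅ (a : ℕ) (b : ℕ) (ρ : BiMatrix a b) (_ : IsState ρ ∧ Generates lam ρ P), size a b

/-- The quantum advantage `𝓢_lam(P)`. The convention `x / ∞ = 0` applies to unreachable `P`. -/
def quantumAdvantage {n : ℕ} (lam : ℝ) (P : Matrix (Fin n) (Fin n) ℝ) : ℝ≥0∞ :=
  classicalCost P / quantumCost lam P

/-- The operator `|ψ⟩⟨ψ|`. -/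
def pureState {a b : ℕ} (ψ : EuclideanSpace ℂ (Fin a × Fin b)) : BiMatrix a b :=
  Matrix.of fun s t => ψ s * star (ψ t)

/-- A bipartite vector is entangled if it is not a product vector. -/
def IsEntangled {a b : ℕ} (ψ : EuclideanSpace ℂ (Fin a × Fin b)) : Prop :=
  ¬ ∃ (u : Fin a → ℂ) (v : Fin b → ℂ), ∀ i j, ψ (i, j) = u i * v j

/-! ### Ranks and Euclidean distance matrices -/

/-- The nonnegative rank of a nonnegative matrix: the least number of nonnegative rank-one
matrices `u vᵀ` that sum to it. -/
def nonnegRank {n : ℕ} (M : Matrix (Fin n) (Fin n) ℝ) : ℕ :=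
  sInf {r : ℕ | ∃ u v : Fin r → Fin n → ℝ,
    (∀ k x, 0 ≤ u k x) ∧ (∀ k y, 0 ≤ v k y) ∧ ∀ x y, M x y = ∑ k, u k x * v k y}

/-- The positive semidefinite rank of a nonnegative matrix. -/
def psdRank {n : ℕ} (M : Matrix (Fin n) (Fin n) ℝ) : ℕ :=
  sInf {r : ℕ | ∃ C D : Fin n → Matrix (Fin r) (Fin r) ℂ,
    (∀ x, (C x).PosSemidef) ∧ (∀ y, (D y).PosSemidef) ∧
      ∀ x y, (M x y : ℂ) = (C x * D y).trace}

/-- The normalized Euclidean distance matrix of the points `α 0, …, α (m - 1)` of the line. -/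
def edm {m : ℕ} (α : Fin m → ℝ) : Matrix (Fin m) (Fin m) ℝ :=
  Matrix.of fun x y => (α x - α y) ^ 2 / ∑ i, ∑ j, (α i - α j) ^ 2

/-- The rescaled matrix `diag(l) · EDM · diag(r)`. -/
def rescaledEdm {m : ℕ} (α l r : Fin m → ℝ) : Matrix (Fin m) (Fin m) ℝ :=
  Matrix.diagonal l * edm α * Matrix.diagonal r

/-- The block-diagonal matrix with blocks `M` and the `1 × 1` matrix `c`. -/
def addCorner {m : ℕ} (M : Matrix (Fin m) (Fin m) ℝ) (c : ℝ) :
    Matrix (Fin (m + 1)) (Fin (m + 1)) ℝ :=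
  Matrix.reindex finSumFinEquiv finSumFinEquiv
    (Matrix.fromBlocks M 0 0 (Matrix.of fun _ _ : Fin 1 => c))

end

end CorrGen

open CorrGen

/-!
An entangled vector has two positive Schmidt coefficients `s₀, s₁`. Both parties first test whether
their system lies in the span of the two Schmidt vectors. The tests fail simultaneously, which
produces the corner, and succeed with probability `s₀² + s₁²`. Inside this span the parties measure
rank-one operators along `(p x, q x)` and `(q y, -p y)`, up to normalization, where `p` and `q` span
the same functions as `1` and `α` and satisfy `p x * q y - q x * p y = α x - α y`. The outcomes are
then distributed like a rescaled distance matrix.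

For algebraically independent `α` such a matrix has large nonnegative rank. Its zero diagonal makes
the two sides of a factorization with `n` terms have disjoint supports. The rows of one side lie in
the space of vectors that interpolate quadratic polynomials through the other side. If `j` is the
dimension of this space, it has a basis that is diagonal in `j` of the coordinates and involves at
most `j * (n - j + 2)` further parameters. Specializing a row to the field generated by these keeps
its zeros, which shows that every `α x` is algebraic over this field. Hence
`m ≤ j * (n - j + 2) ≤ (n + 2)² / 4`.

A seed correlation of size `s` yields a nonnegative factorization with at most `2 ^ s` terms, so the
classical cost grows without bound, while the quantum cost never exceeds the size of `ψ`.
-/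

namespace CorrGen

noncomputable section

open Polynomial

section Schmidt

variable {ι κ n : Type*} [Fintype ι] [Fintype κ]

/-- The columns of `N` and `B` are orthonormal systems of left and right singular vectors of `Ψ` for
the singular values `s`. For the coefficient matrix of a bipartite vector these are terms of its
Schmidt decomposition. -/
structure IsSchmidtPair [Fintype n] [DecidableEq n] (Ψ : Matrix ι κ ℂ) (N : Matrix ι n ℂ)
    (B : Matrix κ n ℂ) (s : n → ℝ) : Prop where
  left_isometry : Nᴴ * N = 1
  right_isometry : Bᴴ * B = 1
  mul_right : Ψ * B = N * Matrix.diagonal fun i => (s i : ℂ)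
  conjTranspose_mul_left : Ψᴴ * N = B * Matrix.diagonal fun i => (s i : ℂ)

theorem IsSchmidtPair.symm [Fintype n] [DecidableEq n] {Ψ : Matrix ι κ ℂ} {N : Matrix ι n ℂ}
    {B : Matrix κ n ℂ} {s : n → ℝ} (h : IsSchmidtPair Ψ N B s) : IsSchmidtPair Ψᴴ B N s :=
  ⟨h.right_isometry, h.left_isometry, h.conjTranspose_mul_left, by
    rw [Matrix.conjTranspose_conjTranspose, h.mul_right]⟩

theorem exists_isometry_mul_eq_mul_diagonal {A : Matrix ι ι ℂ} (hA : A.PosSemidef)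
    {k : ℕ} (hk : k ≤ A.rank) :
    ∃ (N : Matrix ι (Fin k) ℂ) (t : Fin k → ℝ), (∀ i, 0 < t i) ∧ Nᴴ * N = 1 ∧
      A * N = N * Matrix.diagonal fun i => (t i : ℂ) := by
  classical
  set U : Matrix ι ι ℂ := ↑hA.isHermitian.eigenvectorUnitary
  set μ := hA.isHermitian.eigenvalues
  have hU : Uᴴ * U = 1 := Unitary.coe_star_mul_self hA.isHermitian.eigenvectorUnitary
  have hAU : A * U = U * Matrix.diagonal fun i => (μ i : ℂ) := by
    ext i j
    rw [Matrix.mul_diagonal, mul_comm]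
    exact congrFun (hA.isHermitian.mulVec_eigenvectorBasis j) i
  rw [hA.isHermitian.rank_eq_card_non_zero_eigs] at hk
  obtain ⟨e⟩ := Function.Embedding.nonempty_of_card_le
    (α := Fin k) (β := {i // μ i ≠ 0}) (by simpa using hk)
  set f : Fin k → ι := fun i => e i
  have hf : Function.Injective f := Subtype.val_injective.comp e.injective
  refine ⟨U.submatrix id f, μ ∘ f, fun i => (hA.eigenvalues_nonneg _).lt_of_ne' (e i).2, ?_, ?_⟩
  · rw [Matrix.conjTranspose_submatrix, ← Matrix.submatrix_mul _ _ _ _ _ Function.bijective_id, hU,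
      Matrix.submatrix_one _ hf]
  · ext i j
    have := congrFun₂ hAU i (f j)
    rw [Matrix.mul_diagonal] at this ⊢
    exact this

theorem exists_isSchmidtPair {Ψ : Matrix ι κ ℂ} {k : ℕ} (hk : k ≤ Ψ.rank) :
    ∃ (N : Matrix ι (Fin k) ℂ) (B : Matrix κ (Fin k) ℂ) (s : Fin k → ℝ),
      (∀ i, 0 < s i) ∧ IsSchmidtPair Ψ N B s := by
  classical
  rw [← Matrix.rank_self_mul_conjTranspose] at hk
  obtain ⟨N, t, ht, hN, hΨN⟩ :=
    exists_isometry_mul_eq_mul_diagonal (Matrix.posSemidef_self_mul_conjTranspose Ψ) hk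
  set s : Fin k → ℝ := fun i => √(t i)
  have hs : ∀ i, 0 < s i := fun i => Real.sqrt_pos.2 (ht i)
  set D : Matrix (Fin k) (Fin k) ℂ := Matrix.diagonal fun i => (s i : ℂ)
  set D' : Matrix (Fin k) (Fin k) ℂ := Matrix.diagonal fun i => ((s i)⁻¹ : ℂ)
  have hs' : ∀ i, (s i : ℂ) ≠ 0 := fun i => by exact_mod_cast (hs i).ne'
  have hDD' : D * D' = 1 := by simp [D, D', hs']
  have hD'D : D' * D = 1 := by simp [D, D', hs']
  have hD'conj : D'ᴴ = D' := by
    simp only [D', Matrix.diagonal_conjTranspose]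
    congr 1
    ext i
    simp
  have hΨN' : Ψ * (Ψᴴ * N) = N * (D * D) := by
    rw [← Matrix.mul_assoc, hΨN, Matrix.diagonal_mul_diagonal]
    congr 2
    ext i
    rw [← Complex.ofReal_mul, Real.mul_self_sqrt (ht i).le]
  refine ⟨N, Ψᴴ * N * D', s, hs, hN, ?_, ?_, ?_⟩
  · rw [Matrix.conjTranspose_mul, Matrix.conjTranspose_mul, Matrix.conjTranspose_conjTranspose,
      hD'conj, Matrix.mul_assoc, Matrix.mul_assoc Nᴴ, ← Matrix.mul_assoc Ψ, hΨN',
      ← Matrix.mul_assoc Nᴴ, ← Matrix.mul_assoc Nᴴ, hN, Matrix.one_mul, Matrix.mul_assoc D, hDD',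
      Matrix.mul_one, hD'D]
  · rw [← Matrix.mul_assoc, hΨN', Matrix.mul_assoc, Matrix.mul_assoc D, hDD', Matrix.mul_one]
  · rw [Matrix.mul_assoc, hD'D, Matrix.mul_one]

/-- The matrix of coefficients `ψ (i, j)` of a bipartite vector in the product basis. -/
def coeffMatrix {a b : ℕ} (ψ : EuclideanSpace ℂ (Fin a × Fin b)) : Matrix (Fin a) (Fin b) ℂ :=
  Matrix.of fun i j => ψ (i, j)

theorem IsEntangled.two_le_rank_coeffMatrix {a b : ℕ} {ψ : EuclideanSpace ℂ (Fin a × Fin b)}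
    (hψ : IsEntangled ψ) : 2 ≤ (coeffMatrix ψ).rank := by
  by_contra! h
  rw [Matrix.rank_eq_finrank_span_cols, Nat.lt_succ_iff, finrank_le_one_iff] at h
  obtain ⟨u, hu⟩ := h
  choose v hv using fun j => hu ⟨(coeffMatrix ψ).col j, Submodule.subset_span ⟨j, rfl⟩⟩
  refine hψ ⟨u, v, fun i j => ?_⟩
  rw [mul_comm]
  exact (congrFun (congrArg Subtype.val (hv j)) i).symm

end Schmidt

section TranscendenceDegree

open scoped IntermediateField.algebraAdjoinAdjoin in
theorem card_le_of_isAlgebraic_adjoin {ι κ F E : Type*} [Fintype ι] [Fintype κ] [Field F] [Field E]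
    [Algebra F E] {α : ι → E} (hα : AlgebraicIndependent F α) (g : κ → E)
    (h : ∀ x, IsAlgebraic (IntermediateField.adjoin F (Set.range g)) (α x)) :
    Fintype.card ι ≤ Fintype.card κ := by
  have hind : (AlgebraicIndependent.matroid F E).Indep (Set.range α) := hα.to_subtype_range
  have hsub : Set.range α ⊆ (AlgebraicIndependent.matroid F E).closure (Set.range g) := by
    rw [AlgebraicIndependent.matroid_closure_eq]
    rintro _ ⟨x, rfl⟩
    exact (IsFractionRing.isAlgebraic_iff (Algebra.adjoin F (Set.range g))
      (IntermediateField.adjoin F (Set.range g)) E).2 (h x)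
  have hcard : (Fintype.card ι : ℕ∞) ≤ Fintype.card κ := calc
    (Fintype.card ι : ℕ∞) = (Set.range α).encard := by
      rw [← Set.image_univ, hα.injective.encard_image]; simp
    _ ≤ (AlgebraicIndependent.matroid F E).eRk (Set.range g) :=
      (hind.encard_le_eRk_of_subset hsub).trans_eq (Matroid.eRk_closure_eq _ _)
    _ ≤ (Set.range g).encard := Matroid.eRk_le_encard _ _
    _ ≤ Fintype.card κ := by
      rw [← Set.image_univ]
      exact (Set.encard_image_le _ _).trans (by simp)
  exact_mod_cast hcard

theorem exists_algebraicIndependent_real (m : ℕ) :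
    ∃ α : Fin m → ℝ, AlgebraicIndependent ℚ α := by
  obtain ⟨ι, x, hx⟩ := exists_isTranscendenceBasis' ℚ ℝ
  have hinf : Infinite ι := by
    by_contra hfin
    rw [not_infinite_iff_finite] at hfin
    have hcount : Cardinal.mk (Algebra.adjoin ℚ (Set.range x)) ≤ Cardinal.aleph0 := by
      rw [← hx.1.aevalEquiv.toEquiv.cardinal_eq]
      exact MvPolynomial.cardinalMk_le_max.trans (by simp)
    have := hx.isAlgebraic
    have hreal := Algebra.IsAlgebraic.cardinalMk_le_max (Algebra.adjoin ℚ (Set.range x)) ℝ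
    rw [Cardinal.mk_real, max_eq_right hcount] at hreal
    exact hreal.not_gt Cardinal.aleph0_lt_continuum
  exact ⟨x ∘ (Infinite.natEmbedding ι ∘ Fin.val),
    hx.1.comp _ ((Infinite.natEmbedding ι).injective.comp Fin.val_injective)⟩

end TranscendenceDegree

section AdaptedBases

variable {K W ι : Type*} [Field K] [AddCommGroup W] [Module K W]

theorem exists_basis_dual_eq_ite [Finite ι] [DecidableEq ι] {φ : ι → Module.Dual K W}
    (hφ : ⨅ i, LinearMap.ker (φ i) = ⊥) :
    ∃ (J : Set ι) (b : Module.Basis J K W), ∀ i j : J, φ i (b j) = if i = j then 1 else 0 := by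
  obtain ⟨J, -, -, hspan, hind⟩ := exists_linearIndepOn_extension
    (K := K) (v := φ) (linearIndepOn_empty _ _) (Set.empty_subset Set.univ)
  have htop : ⊤ ≤ Submodule.span K (Set.range fun j : J => φ j) := by
    rw [← Set.image_eq_range]
    refine le_trans (fun ℓ _ => ?_) (Submodule.span_le.2 hspan)
    rw [Set.image_univ]
    exact mem_span_of_iInf_ker_le_ker (hφ.trans_le bot_le)
  let dual : Module.Basis J K (Module.Dual K W) := .mk hind htop
  have : Module.Finite K W := (Module.finite_dual_iff K).1 (.of_basis dual)
  refine ⟨J, dual.dualBasis.map (Module.evalEquiv K W).symm, fun i j => ?_⟩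
  have hi : φ i = dual i := (Module.Basis.mk_apply hind htop i).symm
  rw [Module.Basis.map_apply, hi, Module.apply_evalEquiv_symm_apply,
    Module.Basis.dualBasis_apply_self]

theorem exists_basis_pivot_normalized [Finite ι] {φ : ι → Module.Dual K W}
    (hφ : ⨅ i, LinearMap.ker (φ i) = ⊥) (ψ : Module.Dual K W) :
    ∃ (J : Set ι) (b : Module.Basis J K W),
      (∀ i j : J, j ≠ i → φ i (b j) = 0) ∧ ∀ j, ψ (b j) = 0 ∨ ψ (b j) = 1 := by
  classical
  obtain ⟨J, b, hb⟩ := exists_basis_dual_eq_ite hφ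
  have hunit : ∀ j, IsUnit (if ψ (b j) = 0 then 1 else (ψ (b j))⁻¹) := fun j => by
    split_ifs with h <;> simp [h]
  refine ⟨J, b.isUnitSMul hunit, fun i j hji => ?_, fun j => ?_⟩
  · rw [Module.Basis.isUnitSMul_apply, map_smul, hb, if_neg hji.symm, smul_zero]
  · rw [Module.Basis.isUnitSMul_apply, map_smul, smul_eq_mul]
    split_ifs with h <;> simp [h]

end AdaptedBases

section CoordinateSpecialization

variable {F E W J : Type*} [Field F] [Field E] [Algebra F E] [AddCommGroup W] [Module E W]
  [Fintype J]

/-- The vector obtained from `w` by applying `f` to its coordinates in the basis `b`. Taking `f` to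
be `F`-linear with values in the subfield `F` specializes `w` to a vector with coordinates in `F`
that still satisfies the homogeneous linear equations over `F` satisfied by `w`. -/
def mapCoords (b : Module.Basis J E W) (f : E →ₗ[F] F) (w : W) : W :=
  ∑ j, algebraMap F E (f (b.repr w j)) • b j

theorem apply_mapCoords (b : Module.Basis J E W) (f : E →ₗ[F] F) {ℓ : Module.Dual E W}
    (hℓ : ∀ j, ℓ (b j) ∈ Set.range (algebraMap F E)) (w : W) :
    ℓ (mapCoords b f w) = algebraMap F E (f (ℓ w)) := by
  choose c hc using hℓ
  have hw : ℓ w = ∑ j, c j • b.repr w j := by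
    conv_lhs => rw [← b.sum_repr w]
    simp only [map_sum, map_smul, smul_eq_mul, ← hc, Algebra.smul_def, mul_comm]
  simp only [mapCoords, hw, map_sum, map_smul, smul_eq_mul, map_mul, ← hc, mul_comm]

theorem apply_mapCoords_eq_zero (b : Module.Basis J E W) (f : E →ₗ[F] F) {ℓ : Module.Dual E W}
    {i : J} (hℓ : ∀ j, j ≠ i → ℓ (b j) = 0) {w : W} (hw : ℓ w = 0) :
    ℓ (mapCoords b f w) = 0 := by
  have hsum : ∀ c : J → E, ℓ (∑ j, c j • b j) = c i * ℓ (b i) := fun c => by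
    rw [map_sum, Fintype.sum_eq_single i fun j hj => by rw [map_smul, hℓ j hj, smul_zero],
      map_smul, smul_eq_mul]
  rw [← b.sum_repr w, hsum, mul_eq_zero] at hw
  rw [mapCoords, hsum, mul_eq_zero]
  exact hw.imp_left fun h => by rw [h, map_zero, map_zero]

end CoordinateSpecialization

section GenericInterpolation

variable {E ι κ : Type*} [Field E] [Fintype κ]

/-- The space of pairs `(u, p)` such that `p` is a polynomial of degree at most `d` that takes the
value `u ⬝ᵥ V y` at `α y`. A row of coefficients of a factorization `U * Vᵀ` of a matrix with
entries `p_x (α_y)` thus comes with the polynomial `p_x`. -/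
def interpolants (α : ι → E) (V : ι → κ → E) (d : ℕ) : Submodule E ((κ → E) × E[X]) where
  carrier := {w | w.2 ∈ degreeLE E d ∧ ∀ y, w.2.eval (α y) = w.1 ⬝ᵥ V y}
  zero_mem' := by simp
  add_mem' hv hw := ⟨Submodule.add_mem _ hv.1 hw.1, fun y => by
    simp [add_dotProduct, hv.2 y, hw.2 y]⟩
  smul_mem' c _ hw := ⟨Submodule.smul_mem _ c hw.1, fun y => by simp [hw.2 y]⟩

/-- The `k`-th entry of `u`, as a linear functional of the interpolant `(u, p)`. -/
def interpolantEntry (α : ι → E) (V : ι → κ → E) (d : ℕ) (k : κ) :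
    Module.Dual E (interpolants α V d) :=
  LinearMap.proj k ∘ₗ LinearMap.fst E (κ → E) E[X] ∘ₗ (interpolants α V d).subtype

/-- The `n`-th coefficient of `p`, as a linear functional of the interpolant `(u, p)`. -/
def interpolantCoeff (α : ι → E) (V : ι → κ → E) (d n : ℕ) :
    Module.Dual E (interpolants α V d) :=
  lcoeff E n ∘ₗ LinearMap.snd E (κ → E) E[X] ∘ₗ (interpolants α V d).subtype

theorem iInf_ker_interpolantEntry [Fintype ι] {α : ι → E} (hα : Function.Injective α)
    (V : ι → κ → E) {d : ℕ} (hd : d < Fintype.card ι) :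
    ⨅ k, LinearMap.ker (interpolantEntry α V d k) = ⊥ := by
  rw [eq_bot_iff]
  rintro ⟨⟨u, p⟩, hdeg, heval⟩ h
  simp only [Submodule.mem_iInf, LinearMap.mem_ker] at h
  obtain rfl : u = 0 := funext h
  simp only [zero_dotProduct] at heval
  have hp : p = 0 := eq_zero_of_degree_lt_of_eval_index_eq_zero (v := α) Finset.univ
    hα.injOn ((mem_degreeLE.1 hdeg).trans_lt (by exact_mod_cast hd)) fun y _ => heval y
  simp [hp]

variable {F : Type*} [Field F] [Algebra F E]

theorem isAlgebraic_of_coeff_mem_range {p : E[X]} (hp : p ≠ 0)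
    (hcoeff : ∀ n, p.coeff n ∈ Set.range (algebraMap F E)) {t : E} (ht : p.eval t = 0) :
    IsAlgebraic F t := by
  obtain ⟨q, rfl⟩ := (mem_lifts p).1 ((lifts_iff_coeff_lifts p).2 hcoeff)
  exact ⟨q, fun h => hp (by rw [h, Polynomial.map_zero]), by rwa [aeval_def, ← eval_map]⟩

/-- The polynomial of the specialized interpolant has its coefficients in `F`, and disjointness of
the supports makes it vanish at `α x`. -/
theorem isAlgebraic_of_interpolant {α : ι → E} {V : ι → κ → E} {d : ℕ} {J : Set κ} [Finite J]
    (b : Module.Basis J E (interpolants α V d))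
    (hpivot : ∀ i j : J, j ≠ i → interpolantEntry α V d i (b j) = 0)
    (hentry : ∀ k ∉ J, ∀ j, interpolantEntry α V d k (b j) ∈ Set.range (algebraMap F E))
    (hcoeff : ∀ n ≤ d, ∀ j, interpolantCoeff α V d n (b j) ∈ Set.range (algebraMap F E))
    {u : κ → E} {p : E[X]} (hp : p ≠ 0) (hw : (u, p) ∈ interpolants α V d) {x : ι}
    (hdisj : ∀ k, u k * V x k = 0) : IsAlgebraic F (α x) := by
  cases nonempty_fintype J
  obtain ⟨n, hn⟩ : ∃ n, p.coeff n ≠ 0 := by simpa [Polynomial.ext_iff] using hp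
  obtain ⟨f, hf⟩ := Module.Projective.exists_dual_ne_zero F hn
  have hcoeff_lt : ∀ w : interpolants α V d, ∀ n, d < n → interpolantCoeff α V d n w = 0 :=
    fun w n hn => coeff_eq_zero_of_degree_lt
      ((mem_degreeLE.1 w.2.1).trans_lt (by exact_mod_cast hn))
  have hcoeff' : ∀ n j, interpolantCoeff α V d n (b j) ∈ Set.range (algebraMap F E) :=
    fun n j => (le_or_gt n d).elim (hcoeff n · j) fun h => ⟨0, by rw [hcoeff_lt _ n h, map_zero]⟩
  set w' := mapCoords b f ⟨(u, p), hw⟩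
  have hw'coeff : ∀ n, w'.1.2.coeff n = algebraMap F E (f (p.coeff n)) :=
    fun n => apply_mapCoords b f (hcoeff' n) _
  have hw'entry : ∀ k, u k = 0 → w'.1.1 k = 0 := fun k hk => by
    by_cases hkJ : k ∈ J
    · exact apply_mapCoords_eq_zero b f (i := ⟨k, hkJ⟩) (hpivot ⟨k, hkJ⟩) hk
    · have h := apply_mapCoords b f (hentry k hkJ) ⟨(u, p), hw⟩
      rwa [show interpolantEntry α V d k ⟨(u, p), hw⟩ = 0 from hk, map_zero, map_zero] at h
  refine isAlgebraic_of_coeff_mem_range (p := w'.1.2) (fun h => hf ?_)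
    (fun n => ⟨_, (hw'coeff n).symm⟩) ?_
  · simpa [h] using (hw'coeff n).symm
  · rw [w'.2.2 x]
    refine Finset.sum_eq_zero fun k _ => ?_
    rcases mul_eq_zero.1 (hdisj k) with hk | hk
    · rw [hw'entry k hk, zero_mul]
    · rw [hk, mul_zero]

end GenericInterpolation

section GenericFactorization

variable {K E ι κ : Type*} [Field K] [Field E] [Algebra K E] [Fintype ι] [Fintype κ]

/-- The adapted basis of the space of interpolants has `#J * (#κ - #J + d)` free parameters besides
its pivots, and each `α x` is algebraic over the field that they generate. -/
theorem four_mul_card_le_sq_of_sum_mul_eq_eval {α : ι → E} (hα : AlgebraicIndependent K α) {d : ℕ}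
    (hd : d < Fintype.card ι) {p : ι → E[X]} (hp : ∀ x, (p x).degree = d) {U V : ι → κ → E}
    (hUV : ∀ x y, (p x).eval (α y) = ∑ k, U x k * V y k) (hdisj : ∀ x k, U x k * V x k = 0) :
    4 * Fintype.card ι ≤ (Fintype.card κ + d) ^ 2 := by
  classical
  obtain ⟨J, b, hpivot, hlead⟩ := exists_basis_pivot_normalized
    (iInf_ker_interpolantEntry hα.injective V hd) (interpolantCoeff α V d d)
  let g : J × (↥Jᶜ ⊕ Fin d) → E := fun j =>
    Sum.elim (fun k : ↥Jᶜ => interpolantEntry α V d k (b j.1))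
      (fun n : Fin d => interpolantCoeff α V d n (b j.1)) j.2
  set F := IntermediateField.adjoin K (Set.range g)
  have hg : ∀ j, g j ∈ Set.range (algebraMap F E) := fun j =>
    ⟨⟨g j, IntermediateField.subset_adjoin _ _ ⟨j, rfl⟩⟩, rfl⟩
  have hcoeff : ∀ n ≤ d, ∀ j, interpolantCoeff α V d n (b j) ∈ Set.range (algebraMap F E) := by
    intro n hn j
    rcases hn.lt_or_eq with hn | rfl
    · exact hg (j, .inr ⟨n, hn⟩)
    · exact (hlead j).elim (fun h => ⟨0, by rw [h, map_zero]⟩) fun h => ⟨1, by rw [h, map_one]⟩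
  have halg : ∀ x, IsAlgebraic F (α x) := fun x =>
    isAlgebraic_of_interpolant b hpivot (fun k hk j => hg (j, .inl ⟨k, hk⟩)) hcoeff
      (fun h => by simpa [h] using hp x) ⟨mem_degreeLE.2 (hp x).le, hUV x⟩ (hdisj x)
  have hcard := card_le_of_isAlgebraic_adjoin hα g halg
  have hJ : Fintype.card J + Fintype.card ↥Jᶜ = Fintype.card κ := by
    rw [← Fintype.card_sum, Fintype.card_congr (Equiv.Set.sumCompl J)]
  rw [Fintype.card_prod, Fintype.card_sum, Fintype.card_fin] at hcard
  calc 4 * Fintype.card ι ≤ 4 * (Fintype.card J * (Fintype.card ↥Jᶜ + d)) := by gcongr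
    _ ≤ (Fintype.card J + (Fintype.card ↥Jᶜ + d)) ^ 2 := by
      rw [← mul_assoc]
      exact four_mul_le_sq_add _ _
    _ = (Fintype.card κ + d) ^ 2 := by rw [← hJ, add_assoc]

end GenericFactorization

section NonnegFactorization

variable {ι κ : Type*}

/-- `M` is a sum of `r` nonnegative rank-one matrices, so that `nonnegRank M` is the least such `r`
when `M` is square. -/
def HasNonnegFactorization (M : Matrix ι κ ℝ) (r : ℕ) : Prop :=
  ∃ (u : Fin r → ι → ℝ) (v : Fin r → κ → ℝ),
    (∀ k x, 0 ≤ u k x) ∧ (∀ k y, 0 ≤ v k y) ∧ ∀ x y, M x y = ∑ k, u k x * v k y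

theorem HasNonnegFactorization.submatrix {M : Matrix ι κ ℝ} {r : ℕ}
    (h : HasNonnegFactorization M r) {ι' κ' : Type*} (e : ι' → ι) (f : κ' → κ) :
    HasNonnegFactorization (M.submatrix e f) r :=
  let ⟨u, v, hu, hv, huv⟩ := h
  ⟨fun k x => u k (e x), fun k y => v k (f y), fun k _ => hu k _, fun k _ => hv k _,
    fun _ _ => huv _ _⟩

theorem HasNonnegFactorization.pos {M : Matrix ι κ ℝ} {r : ℕ} (h : HasNonnegFactorization M r)
    {x : ι} {y : κ} (hxy : M x y ≠ 0) : 0 < r := by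
  obtain ⟨u, v, -, -, huv⟩ := h
  refine Nat.pos_of_ne_zero ?_
  rintro rfl
  exact hxy (huv x y)

theorem hasNonnegFactorization_of_nonneg {n : ℕ} {M : Matrix (Fin n) κ ℝ}
    (hM : ∀ x y, 0 ≤ M x y) : HasNonnegFactorization M n :=
  ⟨fun k x => if k = x then 1 else 0, M, fun k x => by positivity, hM, fun x y => by simp⟩

theorem HasNonnegFactorization.nonnegRank_le {n r : ℕ} {M : Matrix (Fin n) (Fin n) ℝ}
    (h : HasNonnegFactorization M r) : nonnegRank M ≤ r :=
  Nat.sInf_le h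

theorem hasNonnegFactorization_nonnegRank {n : ℕ} {M : Matrix (Fin n) (Fin n) ℝ}
    (hM : ∀ x y, 0 ≤ M x y) : HasNonnegFactorization M (nonnegRank M) :=
  Nat.sInf_mem (s := {r | HasNonnegFactorization M r}) ⟨n, hasNonnegFactorization_of_nonneg hM⟩

end NonnegFactorization

section RescaledEdm

variable {m : ℕ} {α l r : Fin m → ℝ}

theorem rescaledEdm_apply (α l r : Fin m → ℝ) (x y : Fin m) :
    rescaledEdm α l r x y = l x * r y * ((α x - α y) ^ 2 / ∑ i, ∑ j, (α i - α j) ^ 2) := by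
  simp only [rescaledEdm, Matrix.mul_diagonal, Matrix.diagonal_mul, edm, Matrix.of_apply]
  ring

theorem rescaledEdm_one_one (α : Fin m → ℝ) : rescaledEdm α 1 1 = edm α := by
  simp [rescaledEdm]

theorem smul_rescaledEdm (p : ℝ) (α l r : Fin m → ℝ) :
    p • rescaledEdm α l r = rescaledEdm α (p • l) r := by
  simp [rescaledEdm, Matrix.diagonal_smul]

theorem rescaledEdm_self (α l r : Fin m → ℝ) (x : Fin m) : rescaledEdm α l r x x = 0 := by
  simp [rescaledEdm_apply]

theorem sum_sq_sub_pos (hα : Function.Injective α) {x y : Fin m} (hxy : x ≠ y) :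
    0 < ∑ i, ∑ j, (α i - α j) ^ 2 :=
  Finset.sum_pos' (fun _ _ => by positivity) ⟨x, Finset.mem_univ x,
    Finset.sum_pos' (fun _ _ => by positivity) ⟨y, Finset.mem_univ y,
      sq_pos_of_ne_zero (sub_ne_zero.2 (hα.ne hxy))⟩⟩

theorem rescaledEdm_pos (hα : Function.Injective α) (hl : ∀ x, 0 < l x) (hr : ∀ y, 0 < r y)
    {x y : Fin m} (hxy : x ≠ y) : 0 < rescaledEdm α l r x y := by
  rw [rescaledEdm_apply]
  have := sub_ne_zero.2 (hα.ne hxy)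
  exact mul_pos (mul_pos (hl x) (hr y)) (div_pos (by positivity) (sum_sq_sub_pos hα hxy))

theorem rescaledEdm_nonneg (hα : Function.Injective α) (hl : ∀ x, 0 < l x) (hr : ∀ y, 0 < r y)
    (x y : Fin m) : 0 ≤ rescaledEdm α l r x y := by
  rcases eq_or_ne x y with rfl | hxy
  · exact (rescaledEdm_self α l r x).ge
  · exact (rescaledEdm_pos hα hl hr hxy).le

/-- The zero diagonal makes the supports of a nonnegative factorization disjoint. -/
theorem HasNonnegFactorization.four_mul_le_sq_of_rescaledEdm (hm : 3 ≤ m)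
    (hα : AlgebraicIndependent ℚ α) (hl : ∀ x, 0 < l x) (hr : ∀ y, 0 < r y) {n : ℕ}
    (h : HasNonnegFactorization (rescaledEdm α l r) n) : 4 * m ≤ (n + 2) ^ 2 := by
  obtain ⟨u, v, hu, hv, huv⟩ := h
  set S := ∑ i, ∑ j, (α i - α j) ^ 2
  have hS : 0 < S := sum_sq_sub_pos hα.injective (x := ⟨0, by lia⟩) (y := ⟨1, by lia⟩) (by simp)
  have hdiag : ∀ x k, u k x * v k x = 0 := fun x k =>
    (Finset.sum_eq_zero_iff_of_nonneg fun k _ => mul_nonneg (hu k x) (hv k x)).1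
      ((huv x x).symm.trans (rescaledEdm_self α l r x)) k (Finset.mem_univ k)
  have heval : ∀ x y,
      (C (l x / S) * (X - C (α x)) ^ 2).eval (α y) = ∑ k, u k x * (v k y / r y) := by
    intro x y
    have hsum : ∑ k, u k x * (v k y / r y) = rescaledEdm α l r x y / r y := by
      simp_rw [huv, Finset.sum_div, mul_div_assoc]
    rw [hsum, rescaledEdm_apply, mul_right_comm, mul_div_cancel_right₀ _ (hr y).ne']
    simp only [eval_mul, eval_C, eval_pow, eval_sub, eval_X]
    ring
  simpa using four_mul_card_le_sq_of_sum_mul_eq_eval hα (d := 2) (by simp; lia)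
    (fun x => by simp [(hl x).ne', hS.ne']) heval
    fun x k => by rw [← mul_div_assoc, hdiag, zero_div]

theorem two_mul_sqrt_sub_two_le_nonnegRank_rescaledEdm (hm : 2 ≤ m)
    (hα : AlgebraicIndependent ℚ α) (hl : ∀ x, 0 < l x) (hr : ∀ y, 0 < r y) :
    2 * √(m : ℝ) - 2 ≤ nonnegRank (rescaledEdm α l r) := by
  set n := nonnegRank (rescaledEdm α l r)
  have hfac : HasNonnegFactorization (rescaledEdm α l r) n :=
    hasNonnegFactorization_nonnegRank (rescaledEdm_nonneg hα.injective hl hr)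
  have hsq : 4 * m ≤ (n + 2) ^ 2 := by
    rcases hm.lt_or_eq with hm | rfl
    · exact hfac.four_mul_le_sq_of_rescaledEdm hm hα hl hr
    · have hn : 0 < n := hfac.pos (rescaledEdm_pos hα.injective hl hr zero_ne_one).ne'
      nlinarith
  have hsqrt : √(m : ℝ) ≤ (n + 2) / 2 := Real.sqrt_le_iff.2 ⟨by positivity, by
    have : (4 : ℝ) * m ≤ (n + 2) ^ 2 := by exact_mod_cast hsq
    linarith⟩
  linarith

theorem two_mul_sqrt_sub_two_le_nonnegRank_edm (hm : 2 ≤ m) (hα : AlgebraicIndependent ℚ α) :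
    2 * √(m : ℝ) - 2 ≤ nonnegRank (edm α) := by
  rw [← rescaledEdm_one_one]
  exact two_mul_sqrt_sub_two_le_nonnegRank_rescaledEdm hm hα (fun _ => one_pos) fun _ => one_pos

end RescaledEdm

section PsdFactorization

variable {ι κ : Type*}

/-- `M` has a factorization into positive semidefinite matrices of order `r`, so that `psdRank M` is
the least such `r` when `M` is square. -/
def HasPsdFactorization (M : Matrix ι κ ℝ) (r : ℕ) : Prop :=
  ∃ (A : ι → Matrix (Fin r) (Fin r) ℂ) (B : κ → Matrix (Fin r) (Fin r) ℂ),
    (∀ x, (A x).PosSemidef) ∧ (∀ y, (B y).PosSemidef) ∧ ∀ x y, (M x y : ℂ) = (A x * B y).trace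

theorem trace_mul_of_subsingleton {R : Type*} [CommSemiring R] [Fintype ι] [Subsingleton ι]
    (A B : Matrix ι ι R) : (A * B).trace = A.trace * B.trace := by
  rcases isEmpty_or_nonempty ι with _ | ⟨⟨i⟩⟩
  · simp [Matrix.trace]
  · have := uniqueOfSubsingleton i
    simp [Matrix.trace, Matrix.mul_apply]

theorem HasPsdFactorization.two_le {M : Matrix ι ι ℝ} {r : ℕ} (h : HasPsdFactorization M r)
    {x y : ι} (hxx : M x x = 0) (hxy : M x y ≠ 0) (hyx : M y x ≠ 0) : 2 ≤ r := by
  obtain ⟨A, B, -, -, hAB⟩ := h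
  by_contra! hr
  have : Subsingleton (Fin r) := Fin.subsingleton_iff_le_one.2 (by lia)
  have hprod : (M x y * M y x : ℂ) = M x x * M y y := by
    simp only [hAB, trace_mul_of_subsingleton]
    ring
  rw [hxx, Complex.ofReal_zero, zero_mul, ← Complex.ofReal_mul, Complex.ofReal_eq_zero] at hprod
  exact mul_ne_zero hxy hyx hprod

/-- The complex matrix `c v vᵀ` of a real weight `c` and a real vector `v`. -/
def realOuter (c : ℝ) (v : κ → ℝ) : Matrix κ κ ℂ :=
  (c • Matrix.vecMulVec v v).map Complex.ofRealHom

theorem posSemidef_realOuter [Finite κ] {c : ℝ} (hc : 0 ≤ c) (v : κ → ℝ) :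
    (realOuter c v).PosSemidef := by
  have : realOuter c v =
      (c : ℂ) • Matrix.vecMulVec (fun i => (v i : ℂ)) (star fun i => (v i : ℂ)) := by
    ext i j
    simp [realOuter, Matrix.vecMulVec_apply]
  rw [this]
  exact (Matrix.posSemidef_vecMulVec_self_star _).smul (by exact_mod_cast hc)

theorem trace_realOuter_mul_realOuter [Fintype κ] (c d : ℝ) (v w : κ → ℝ) :
    (realOuter c v * realOuter d w).trace = ((c * d * (v ⬝ᵥ w) ^ 2 : ℝ) : ℂ) := by
  rw [realOuter, realOuter, ← Matrix.map_mul, ← AddMonoidHom.map_trace]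
  simp only [Matrix.mul_smul, Matrix.smul_mul, Matrix.vecMulVec_mul_vecMulVec,
    Matrix.vecMulVec_smul, Matrix.trace_smul, Matrix.trace_vecMulVec, smul_eq_mul,
    Complex.ofRealHom_eq_coe, Complex.ofReal_mul, Complex.ofReal_pow]
  ring

theorem hasPsdFactorization_rescaledEdm {m : ℕ} (α : Fin m → ℝ) {l r : Fin m → ℝ}
    (hl : ∀ x, 0 ≤ l x) (hr : ∀ y, 0 ≤ r y) : HasPsdFactorization (rescaledEdm α l r) 2 := by
  refine ⟨fun x => realOuter (l x / ∑ i, ∑ j, (α i - α j) ^ 2) ![1, α x],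
    fun y => realOuter (r y) ![α y, -1],
    fun x => posSemidef_realOuter (div_nonneg (hl x) (by positivity)) _,
    fun y => posSemidef_realOuter (hr y) _, fun x y => ?_⟩
  rw [trace_realOuter_mul_realOuter, rescaledEdm_apply, Matrix.vec2_dotProduct']
  ring_nf

theorem psdRank_rescaledEdm {m : ℕ} (hm : 2 ≤ m) {α l r : Fin m → ℝ} (hα : Function.Injective α)
    (hl : ∀ x, 0 < l x) (hr : ∀ y, 0 < r y) : psdRank (rescaledEdm α l r) = 2 := by
  have : Nontrivial (Fin m) := Fin.nontrivial_iff_two_le.2 hm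
  obtain ⟨x, y, hxy⟩ := exists_pair_ne (Fin m)
  have hfac := hasPsdFactorization_rescaledEdm α (fun x => (hl x).le) fun y => (hr y).le
  refine (Nat.sInf_le hfac).antisymm (le_csInf ⟨2, hfac⟩ fun n hn => ?_)
  exact HasPsdFactorization.two_le hn (rescaledEdm_self α l r x)
    (rescaledEdm_pos hα hl hr hxy).ne' (rescaledEdm_pos hα hl hr hxy.symm).ne'

theorem psdRank_edm {m : ℕ} (hm : 2 ≤ m) {α : Fin m → ℝ} (hα : Function.Injective α) :
    psdRank (edm α) = 2 := by
  rw [← rescaledEdm_one_one]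
  exact psdRank_rescaledEdm hm hα (fun _ => one_pos) fun _ => one_pos

end PsdFactorization

section Measurements

theorem noise_zero {a b : ℕ} (ρ : BiMatrix a b) : noise 0 ρ = ρ := by
  simp [noise, noiseLeft, noiseRight]

theorem trace_mul_nonneg_of_posSemidef {𝕜 ι : Type*} [RCLike 𝕜] [Fintype ι]
    {A B : Matrix ι ι 𝕜} (hA : A.PosSemidef) (hB : B.PosSemidef) : 0 ≤ (A * B).trace := by
  obtain ⟨m, v, rfl⟩ := Matrix.posSemidef_iff_eq_sum_vecMulVec.1 hB
  rw [Matrix.mul_sum, Matrix.trace_sum]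
  refine Finset.sum_nonneg fun i _ => ?_
  rw [Matrix.mul_vecMulVec, Matrix.trace_vecMulVec, dotProduct_comm]
  exact hA.dotProduct_mulVec_nonneg (v i)

theorem IsPOVM.sum_sum_kronecker {n n' a b : ℕ} {E : Fin n → Matrix (Fin a) (Fin a) ℂ}
    {F : Fin n' → Matrix (Fin b) (Fin b) ℂ} (hE : IsPOVM E) (hF : IsPOVM F) :
    ∑ x, ∑ y, E x ⊗ₖ F y = 1 := by
  rw [← Matrix.one_kronecker_one, ← hE.sum_eq_one, ← hF.sum_eq_one]
  ext s t
  simp [Matrix.sum_apply, Finset.sum_mul_sum]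

theorem IsPOVM.transpose {n d : ℕ} {E : Fin n → Matrix (Fin d) (Fin d) ℂ} (hE : IsPOVM E) :
    IsPOVM fun x => (E x)ᵀ :=
  ⟨fun x => (hE.posSemidef x).transpose, by
    rw [← Matrix.transpose_sum, hE.sum_eq_one, Matrix.transpose_one]⟩

theorem isPOVM_single {n : ℕ} (x : Fin n) (d : ℕ) :
    IsPOVM (Pi.single x 1 : Fin n → Matrix (Fin d) (Fin d) ℂ) := by
  refine ⟨fun y => ?_, by simp⟩
  rcases eq_or_ne y x with rfl | hy
  · simpa using Matrix.PosSemidef.one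
  · simpa [hy] using Matrix.PosSemidef.zero

theorem Generates.isCorrelation {a b n : ℕ} {ρ : BiMatrix a b} (hρ : IsState ρ)
    {P : Matrix (Fin n) (Fin n) ℝ} (hP : Generates 0 ρ P) : IsCorrelation P := by
  obtain ⟨E, F, hE, hF, hP⟩ := hP
  simp only [noise_zero] at hP
  refine ⟨fun x y => ?_, ?_⟩
  · rw [← Complex.zero_le_real, hP]
    exact trace_mul_nonneg_of_posSemidef ((hE.posSemidef x).kronecker (hF.posSemidef y))
      hρ.posSemidef
  · have : (∑ x, ∑ y, (P x y : ℂ)) = 1 := by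
      simp only [hP, ← Matrix.trace_sum, ← Finset.sum_mul]
      rw [hE.sum_sum_kronecker hF, Matrix.one_mul, hρ.trace_eq_one]
    exact_mod_cast this

theorem IsState.exists_generates {a b : ℕ} {ρ : BiMatrix a b} (hρ : IsState ρ) (n : ℕ) :
    ∃ P : Matrix (Fin (n + 1)) (Fin (n + 1)) ℝ, Generates 0 ρ P := by
  refine ⟨Matrix.single 0 0 1, _, _, isPOVM_single 0 a, isPOVM_single 0 b, fun x y => ?_⟩
  rw [noise_zero]
  by_cases hx : x = 0 <;> by_cases hy : y = 0 <;> simp [hx, hy, hρ.trace_eq_one, Ne.symm]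

variable {a b : ℕ} {ψ : EuclideanSpace ℂ (Fin a × Fin b)}

theorem isState_pureState (hψ : ‖ψ‖ = 1) : IsState (pureState ψ) := by
  refine ⟨Matrix.posSemidef_vecMulVec_self_star ψ.ofLp, ?_⟩
  have htrace : (pureState ψ).trace = inner ℂ ψ ψ := rfl
  rw [htrace, inner_self_eq_norm_sq_to_K, hψ]
  simp

theorem trace_kronecker_mul_pureState (ψ : EuclideanSpace ℂ (Fin a × Fin b))
    (E : Matrix (Fin a) (Fin a) ℂ) (F : Matrix (Fin b) (Fin b) ℂ) :
    ((E ⊗ₖ F) * pureState ψ).trace = (E * coeffMatrix ψ * Fᵀ * (coeffMatrix ψ)ᴴ).trace := by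
  simp only [Matrix.trace, Matrix.diag, Matrix.mul_apply, Fintype.sum_prod_type,
    Matrix.kroneckerMap_apply, pureState, Matrix.of_apply, coeffMatrix, Matrix.transpose_apply,
    Matrix.conjTranspose_apply, Finset.sum_mul]
  refine Finset.sum_congr rfl fun i _ => Finset.sum_congr rfl fun j _ => ?_
  rw [Finset.sum_comm]
  refine Finset.sum_congr rfl fun k _ => Finset.sum_congr rfl fun l _ => ?_
  ring

theorem trace_coeffMatrix_mul_conjTranspose (hψ : ‖ψ‖ = 1) :
    (coeffMatrix ψ * (coeffMatrix ψ)ᴴ).trace = 1 := by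
  simpa [(isState_pureState hψ).trace_eq_one] using (trace_kronecker_mul_pureState ψ 1 1).symm

theorem generates_pureState {n : ℕ} {P : Matrix (Fin n) (Fin n) ℝ}
    {E : Fin n → Matrix (Fin a) (Fin a) ℂ} {F : Fin n → Matrix (Fin b) (Fin b) ℂ} (hE : IsPOVM E)
    (hF : IsPOVM F)
    (hP : ∀ x y, (P x y : ℂ) = (E x * coeffMatrix ψ * F y * (coeffMatrix ψ)ᴴ).trace) :
    Generates 0 (pureState ψ) P :=
  ⟨E, fun y => (F y)ᵀ, hE, hF.transpose, fun x y => by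
    rw [hP, noise_zero, trace_kronecker_mul_pureState, Matrix.transpose_transpose]⟩

end Measurements

section Extension

theorem posSemidef_one_sub_mul_conjTranspose {𝕜 ι κ : Type*} [RCLike 𝕜] [Fintype ι]
    [DecidableEq ι] [Fintype κ] [DecidableEq κ] {N : Matrix ι κ 𝕜} (hN : Nᴴ * N = 1) :
    (1 - N * Nᴴ).PosSemidef := by
  have hsq : N * Nᴴ * (N * Nᴴ) = N * Nᴴ := by
    rw [Matrix.mul_assoc, ← Matrix.mul_assoc Nᴴ, hN, Matrix.one_mul]
  have hproj : (1 - N * Nᴴ)ᴴ * (1 - N * Nᴴ) = 1 - N * Nᴴ := by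
    simp [Matrix.mul_sub, Matrix.sub_mul, hsq]
  rw [← hproj]
  exact Matrix.posSemidef_conjTranspose_mul_self _

/-- The measurement `T` on the range of the isometry `N`, completed by the outcome that the state
lies in the orthogonal complement. -/
def extendPOVM {n d k : ℕ} (N : Matrix (Fin d) (Fin k) ℂ) (T : Fin n → Matrix (Fin k) (Fin k) ℂ) :
    Fin (n + 1) → Matrix (Fin d) (Fin d) ℂ :=
  Fin.snoc (α := fun _ => Matrix (Fin d) (Fin d) ℂ) (fun x => N * T x * Nᴴ) (1 - N * Nᴴ)

theorem isPOVM_extendPOVM {n d k : ℕ} {N : Matrix (Fin d) (Fin k) ℂ} (hN : Nᴴ * N = 1)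
    {T : Fin n → Matrix (Fin k) (Fin k) ℂ} (hT : IsPOVM T) : IsPOVM (extendPOVM N T) := by
  refine ⟨fun x => ?_, ?_⟩
  · cases x using Fin.lastCases with
    | last => simpa [extendPOVM] using posSemidef_one_sub_mul_conjTranspose hN
    | cast x => simpa [extendPOVM] using (hT.posSemidef x).mul_mul_conjTranspose_same N
  · simp only [extendPOVM, Fin.sum_univ_castSucc, Fin.snoc_castSucc, Fin.snoc_last]
    rw [← Matrix.sum_mul, ← Matrix.mul_sum, hT.sum_eq_one, Matrix.mul_one, add_sub_cancel]

namespace IsSchmidtPair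

variable {ι κ n : Type*} [Fintype ι] [Fintype κ] [Fintype n] [DecidableEq n] {Ψ : Matrix ι κ ℂ}
  {N : Matrix ι n ℂ} {B : Matrix κ n ℂ} {s : n → ℝ}

theorem conjTranspose_mul_mul (h : IsSchmidtPair Ψ N B s) :
    Nᴴ * Ψ * B = Matrix.diagonal fun i => (s i : ℂ) := by
  rw [Matrix.mul_assoc, h.mul_right, ← Matrix.mul_assoc, h.left_isometry, Matrix.one_mul]

theorem trace_mul_mul_mul (h : IsSchmidtPair Ψ N B s) (T S : Matrix n n ℂ) :
    (N * T * Nᴴ * Ψ * (B * S * Bᴴ) * Ψᴴ).trace =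
      (T * Matrix.diagonal (fun i => (s i : ℂ)) * S *
        Matrix.diagonal fun i => (s i : ℂ)).trace := by
  calc (N * T * Nᴴ * Ψ * (B * S * Bᴴ) * Ψᴴ).trace
      = (N * (T * (Nᴴ * Ψ * B) * S * (Bᴴ * Ψᴴ))).trace := by simp only [Matrix.mul_assoc]
    _ = (T * (Nᴴ * Ψ * B) * S * (Bᴴ * Ψᴴ * N)).trace := by
      rw [Matrix.trace_mul_comm, Matrix.mul_assoc _ _ N]
    _ = _ := by rw [h.conjTranspose_mul_mul, h.symm.conjTranspose_mul_mul]

theorem one_sub_mul_mul [DecidableEq ι] (h : IsSchmidtPair Ψ N B s) :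
    (1 - N * Nᴴ) * Ψ * B = 0 := by
  rw [Matrix.mul_assoc, h.mul_right, Matrix.sub_mul, Matrix.mul_assoc, ← Matrix.mul_assoc Nᴴ,
    h.left_isometry, Matrix.one_mul, Matrix.one_mul, sub_self]

theorem trace_one_sub_mul_mul [DecidableEq ι] (h : IsSchmidtPair Ψ N B s) (S : Matrix n n ℂ) :
    ((1 - N * Nᴴ) * Ψ * (B * S * Bᴴ) * Ψᴴ).trace = 0 := by
  simp only [← Matrix.mul_assoc, h.one_sub_mul_mul, Matrix.zero_mul, Matrix.trace_zero]

theorem trace_mul_one_sub [DecidableEq κ] (h : IsSchmidtPair Ψ N B s) (T : Matrix n n ℂ) :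
    (N * T * Nᴴ * Ψ * (1 - B * Bᴴ) * Ψᴴ).trace = 0 := by
  rw [Matrix.mul_assoc _ (1 - B * Bᴴ), Matrix.mul_assoc _ Ψ, Matrix.trace_mul_comm,
    Matrix.mul_assoc Ψ, Matrix.trace_mul_comm Ψ]
  simpa using h.symm.trace_one_sub_mul_mul T

theorem trace_one_sub_mul_one_sub [DecidableEq ι] [DecidableEq κ] (h : IsSchmidtPair Ψ N B s) :
    ((1 - N * Nᴴ) * Ψ * (1 - B * Bᴴ) * Ψᴴ).trace = (Ψ * Ψᴴ).trace - ∑ i, (s i : ℂ) ^ 2 := by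
  have hrange : (N * Nᴴ * Ψ * Ψᴴ).trace = ∑ i, (s i : ℂ) ^ 2 := by
    rw [Matrix.mul_assoc, Matrix.mul_assoc, Matrix.trace_mul_comm, Matrix.mul_assoc,
      Matrix.mul_assoc, h.conjTranspose_mul_left, ← Matrix.mul_assoc, ← Matrix.mul_assoc,
      h.conjTranspose_mul_mul, Matrix.diagonal_mul_diagonal, Matrix.trace_diagonal]
    simp only [sq]
  rw [Matrix.mul_sub _ 1, ← Matrix.mul_assoc _ B, h.one_sub_mul_mul, Matrix.zero_mul, sub_zero,
    Matrix.mul_one, Matrix.sub_mul, Matrix.sub_mul, Matrix.one_mul, Matrix.trace_sub, hrange]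

theorem sum_sq_le_one (h : IsSchmidtPair Ψ N B s) (hΨ : (Ψ * Ψᴴ).trace = 1) :
    ∑ i, s i ^ 2 ≤ 1 := by
  classical
  have hcorner := trace_mul_nonneg_of_posSemidef
    (posSemidef_one_sub_mul_conjTranspose h.left_isometry)
    ((posSemidef_one_sub_mul_conjTranspose h.right_isometry).mul_mul_conjTranspose_same Ψ)
  rw [← Matrix.mul_assoc, ← Matrix.mul_assoc, h.trace_one_sub_mul_one_sub, hΨ, sub_nonneg]
    at hcorner
  exact_mod_cast hcorner

end IsSchmidtPair

theorem addCorner_submatrix_castSucc {m : ℕ} (M : Matrix (Fin m) (Fin m) ℝ) (c : ℝ) :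
    (addCorner M c).submatrix Fin.castSucc Fin.castSucc = M := by
  ext x y
  simp [addCorner]

theorem IsSchmidtPair.generates_addCorner {a b n k : ℕ} {ψ : EuclideanSpace ℂ (Fin a × Fin b)}
    (hψ : ‖ψ‖ = 1) {N : Matrix (Fin a) (Fin k) ℂ} {B : Matrix (Fin b) (Fin k) ℂ} {s : Fin k → ℝ}
    (h : IsSchmidtPair (coeffMatrix ψ) N B s) {T S : Fin n → Matrix (Fin k) (Fin k) ℂ}
    (hT : IsPOVM T) (hS : IsPOVM S) {M : Matrix (Fin n) (Fin n) ℝ}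
    (hM : ∀ x y, (M x y : ℂ) = (T x * Matrix.diagonal (fun i => (s i : ℂ)) * S y *
      Matrix.diagonal fun i => (s i : ℂ)).trace) :
    Generates 0 (pureState ψ) (addCorner M (1 - ∑ i, s i ^ 2)) := by
  refine generates_pureState (isPOVM_extendPOVM h.left_isometry hT)
    (isPOVM_extendPOVM h.right_isometry hS) fun x y => ?_
  cases x using Fin.lastCases <;> cases y using Fin.lastCases
  · simp [addCorner, extendPOVM, h.trace_one_sub_mul_one_sub,
      trace_coeffMatrix_mul_conjTranspose hψ]
  · simp [addCorner, extendPOVM, h.trace_one_sub_mul_mul]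
  · simp [addCorner, extendPOVM, h.trace_mul_one_sub]
  · simp [addCorner, extendPOVM, h.trace_mul_mul_mul, hM]

end Extension

section Weights

/-- Replacing `(1, α)` by another basis `(p, q)` of its span makes `p` vanish at a point `x₀`. The
weights at `x₀` then affect only the second moment of `q` and can be used to adjust it. -/
theorem exists_weights_orthogonal {ι : Type*} [Fintype ι] [Nontrivial ι] {α : ι → ℝ}
    (hα : Function.Injective α) {s t : ℝ} (hs : 0 < s) (ht : 0 < t) :
    ∃ c d p q : ι → ℝ, (∀ x, 0 < c x) ∧ (∀ x, 0 < d x) ∧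
      (∀ x y, p x * q y - q x * p y = α x - α y) ∧
      ∑ x, c x * (p x * q x) = 0 ∧ ∑ x, d x * (p x * q x) = 0 ∧
      0 < ∑ x, c x * p x ^ 2 ∧ 0 < ∑ x, c x * q x ^ 2 ∧
      ∑ x, d x * p x ^ 2 = t * ∑ x, c x * p x ^ 2 ∧
      ∑ x, d x * q x ^ 2 = s * ∑ x, c x * q x ^ 2 := by
  classical
  obtain ⟨x₀, x₁, hx⟩ := exists_pair_ne ι
  set off := Finset.univ.erase x₀
  have hoff : x₁ ∈ off := Finset.mem_erase.2 ⟨hx.symm, Finset.mem_univ _⟩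
  have hsum : ∀ (v w : ℝ) (f : ι → ℝ),
      ∑ x, (if x = x₀ then v else w) * f x = v * f x₀ + w * ∑ x ∈ off, f x := fun v w f => by
    rw [← Finset.add_sum_erase _ _ (Finset.mem_univ x₀), if_pos rfl, Finset.mul_sum]
    exact congrArg _ (Finset.sum_congr rfl fun x hx => by rw [if_neg (Finset.ne_of_mem_erase hx)])
  set p : ι → ℝ := fun x => α x - α x₀
  have hp₀ : p x₀ = 0 := sub_self _
  have hp : 0 < ∑ x ∈ off, p x ^ 2 := Finset.sum_pos' (fun x _ => sq_nonneg _)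
    ⟨x₁, hoff, sq_pos_of_ne_zero (sub_ne_zero.2 (hα.ne hx.symm))⟩
  set β := (∑ x ∈ off, p x) / ∑ x ∈ off, p x ^ 2
  set q : ι → ℝ := fun x => 1 - β * p x
  have hq₀ : q x₀ = 1 := by simp [q, hp₀]
  have hpq : ∑ x ∈ off, p x * q x = 0 := by
    calc ∑ x ∈ off, p x * q x = ∑ x ∈ off, p x - β * ∑ x ∈ off, p x ^ 2 := by
          rw [Finset.mul_sum, ← Finset.sum_sub_distrib]
          exact Finset.sum_congr rfl fun x _ => by ring
      _ = 0 := by rw [div_mul_cancel₀ _ hp.ne', sub_self]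
  set L := ∑ x ∈ off, q x ^ 2
  have : 0 ≤ L := Finset.sum_nonneg fun x _ => sq_nonneg _
  refine ⟨fun x => if x = x₀ then (t * L + 1) / s else 1,
    fun x => if x = x₀ then s * L + 1 else t, p, q, fun x => ?_, fun x => ?_, fun x y => by ring,
    ?_⟩
  · dsimp only
    split_ifs <;> positivity
  · dsimp only
    split_ifs <;> positivity
  · simp only [hsum, hpq, hp₀, hq₀]
    refine ⟨by ring, by ring, by linarith, by positivity, by ring, ?_⟩
    field_simp
    ring

theorem isPOVM_realOuter {n k : ℕ} {c : Fin n → ℝ} {v : Fin n → Fin k → ℝ} (hc : ∀ x, 0 ≤ c x)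
    (hv : ∑ x, c x • Matrix.vecMulVec (v x) (v x) = 1) :
    IsPOVM fun x => realOuter (c x) (v x) := by
  refine ⟨fun x => posSemidef_realOuter (hc x) _, ?_⟩
  have := congrArg (Complex.ofRealHom.mapMatrix (m := Fin k)) hv
  rwa [map_sum, map_one] at this

theorem isPOVM_realOuter_of_orthogonal {n : ℕ} {c p q : Fin n → ℝ} (hc : ∀ x, 0 ≤ c x)
    (hpq : ∑ x, c x * (p x * q x) = 0) (hp : 0 < ∑ x, c x * p x ^ 2)
    (hq : 0 < ∑ x, c x * q x ^ 2) :
    IsPOVM fun x => realOuter (c x)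
      ![p x / √(∑ x, c x * p x ^ 2), q x / √(∑ x, c x * q x ^ 2)] := by
  set P := ∑ x, c x * p x ^ 2
  set Q := ∑ x, c x * q x ^ 2
  have hmixed : ∑ x, c x * (p x / √P * (q x / √Q)) = 0 := by
    rw [← zero_div (√P * √Q), ← hpq, Finset.sum_div]
    exact Finset.sum_congr rfl fun x _ => by ring
  have hsq : ∀ {f : Fin n → ℝ} {S : ℝ}, ∑ x, c x * f x ^ 2 = S → 0 < S →
      ∑ x, c x * (f x / √S * (f x / √S)) = 1 := fun {f S} hS hpos => by
    rw [← div_self hpos.ne', Finset.sum_congr rfl fun x _ => show _ = c x * f x ^ 2 / S by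
      rw [div_mul_div_comm, Real.mul_self_sqrt hpos.le]; ring, ← Finset.sum_div, hS]
  refine isPOVM_realOuter hc ?_
  ext i j
  fin_cases i <;> fin_cases j <;>
    simp [Matrix.sum_apply, hsq (f := p) rfl hp, hsq (f := q) rfl hq, hmixed,
      mul_comm (q _ / _) (p _ / _), P, Q]

theorem diagonal_mul_realOuter_mul_diagonal {κ : Type*} [Fintype κ] [DecidableEq κ] (s : κ → ℝ)
    (c : ℝ) (v : κ → ℝ) :
    (Matrix.diagonal fun i => (s i : ℂ)) * realOuter c v * (Matrix.diagonal fun i => (s i : ℂ)) =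
      realOuter c (s * v) := by
  ext i j
  simp only [realOuter, Matrix.mul_diagonal, Matrix.diagonal_mul, Matrix.map_apply,
    Matrix.smul_apply, Matrix.vecMulVec_apply, smul_eq_mul, Complex.ofRealHom_eq_coe,
    Complex.ofReal_mul, Pi.mul_apply]
  ring

theorem exists_isPOVM_trace_eq_sq_sub {m : ℕ} (hm : 2 ≤ m) {α : Fin m → ℝ}
    (hα : Function.Injective α) {s : Fin 2 → ℝ} (hs : ∀ i, 0 < s i) :
    ∃ (l r : Fin m → ℝ) (T S : Fin m → Matrix (Fin 2) (Fin 2) ℂ),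
      (∀ x, 0 < l x) ∧ (∀ y, 0 < r y) ∧ IsPOVM T ∧ IsPOVM S ∧
      ∀ x y, (T x * Matrix.diagonal (fun i => (s i : ℂ)) * S y *
        Matrix.diagonal fun i => (s i : ℂ)).trace = ((l x * r y * (α x - α y) ^ 2 : ℝ) : ℂ) := by
  have : Nontrivial (Fin m) := Fin.nontrivial_iff_two_le.2 hm
  have hs₀ := hs 0
  have hs₁ := hs 1
  obtain ⟨c, d, p, q, hc, hd, hpq, hc₀, hd₀, hP, hQ, hdP, hdQ⟩ :=
    exists_weights_orthogonal hα (pow_pos hs₀ 2) (pow_pos hs₁ 2)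
  have hT := isPOVM_realOuter_of_orthogonal (fun x => (hc x).le) hc₀ hP hQ
  have hS := isPOVM_realOuter_of_orthogonal (p := q) (q := -p) (fun x => (hd x).le)
    (by simpa [mul_comm] using hd₀) (by rw [hdQ]; positivity)
    (by simp only [Pi.neg_apply, neg_sq, hdP]; positivity)
  set P := ∑ x, c x * p x ^ 2
  set Q := ∑ x, c x * q x ^ 2
  refine ⟨fun x => c x / (P * Q), d, _, _, fun x => div_pos (hc x) (mul_pos hP hQ), hd, hT, hS,
    fun x y => ?_⟩
  have hdot : ![p x / √P, q x / √Q] ⬝ᵥ (s * ![q y / √(s 0 ^ 2 * Q), -p y / √(s 1 ^ 2 * P)]) =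
      (α x - α y) / (√P * √Q) := by
    rw [← hpq x y, Real.sqrt_mul (sq_nonneg _), Real.sqrt_mul (sq_nonneg _), Real.sqrt_sq hs₀.le,
      Real.sqrt_sq hs₁.le]
    simp only [dotProduct, Pi.mul_apply, Fin.sum_univ_two, Matrix.cons_val_zero,
      Matrix.cons_val_one, Matrix.cons_val_fin_one]
    field_simp
    ring
  simp only [Pi.neg_apply, neg_sq, hdP, hdQ]
  rw [Matrix.mul_assoc, Matrix.mul_assoc, ← Matrix.mul_assoc _ (realOuter _ _),
    diagonal_mul_realOuter_mul_diagonal, trace_realOuter_mul_realOuter, hdot, div_pow, mul_pow,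
    Real.sq_sqrt hP.le, Real.sq_sqrt hQ.le]
  ring_nf

theorem exists_generates_rescaledEdm {a b : ℕ} {ψ : EuclideanSpace ℂ (Fin a × Fin b)}
    (hψ : ‖ψ‖ = 1) (hent : IsEntangled ψ) :
    ∃ p : ℝ, 0 < p ∧ p ≤ 1 ∧ ∀ {m : ℕ}, 2 ≤ m → ∀ {α : Fin m → ℝ}, Function.Injective α →
      ∃ l r : Fin m → ℝ, (∀ x, 0 < l x) ∧ (∀ y, 0 < r y) ∧
        Generates 0 (pureState ψ) (addCorner (p • rescaledEdm α l r) (1 - p)) := by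
  obtain ⟨N, B, s, hs, hpair⟩ := exists_isSchmidtPair hent.two_le_rank_coeffMatrix
  set p := ∑ i, s i ^ 2
  have hp : 0 < p := Finset.sum_pos (fun i _ => pow_pos (hs i) 2) Finset.univ_nonempty
  refine ⟨p, hp, hpair.sum_sq_le_one (trace_coeffMatrix_mul_conjTranspose hψ),
    fun {m} hm {α} hα => ?_⟩
  obtain ⟨l, r, T, S, hl, hr, hT, hS, hTS⟩ := exists_isPOVM_trace_eq_sq_sub hm hα hs
  set Δ := ∑ i, ∑ j, (α i - α j) ^ 2 with hΔ_def
  have hΔ : 0 < Δ := sum_sq_sub_pos hα (x := ⟨0, by lia⟩) (y := ⟨1, by lia⟩) (by simp)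
  refine ⟨fun x => Δ / p * l x, r, fun x => mul_pos (div_pos hΔ hp) (hl x), hr,
    hpair.generates_addCorner hψ hT hS fun x y => ?_⟩
  rw [hTS, Matrix.smul_apply, rescaledEdm_apply, smul_eq_mul, ← hΔ_def]
  congr 1
  field_simp

end Weights

section Costs

theorem nonnegRank_le_nonnegRank_addCorner {m : ℕ} {M : Matrix (Fin m) (Fin m) ℝ} {c : ℝ}
    (h : ∀ x y, 0 ≤ addCorner M c x y) : nonnegRank M ≤ nonnegRank (addCorner M c) := by
  have := (hasNonnegFactorization_nonnegRank h).submatrix Fin.castSucc Fin.castSucc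
  rw [addCorner_submatrix_castSucc] at this
  exact this.nonnegRank_le

theorem two_mul_sqrt_sub_two_le_nonnegRank_addCorner {m : ℕ} (hm : 2 ≤ m) {α l r : Fin m → ℝ}
    (hα : AlgebraicIndependent ℚ α) (hl : ∀ x, 0 < l x) (hr : ∀ y, 0 < r y) {p c : ℝ} (hp : 0 < p)
    (h : ∀ x y, 0 ≤ addCorner (p • rescaledEdm α l r) c x y) :
    2 * √(m : ℝ) - 2 ≤ nonnegRank (addCorner (p • rescaledEdm α l r) c) := by
  rw [smul_rescaledEdm] at h ⊢
  calc 2 * √(m : ℝ) - 2 ≤ nonnegRank (rescaledEdm α (p • l) r) :=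
        two_mul_sqrt_sub_two_le_nonnegRank_rescaledEdm hm hα (fun x => mul_pos hp (hl x)) hr
    _ ≤ nonnegRank (addCorner (rescaledEdm α (p • l) r) c) := by
      exact_mod_cast nonnegRank_le_nonnegRank_addCorner h

theorem tendsto_atTop_of_two_mul_sqrt_sub_two_le {f : ℕ → ℕ}
    (hf : ∀ m : ℕ, 2 ≤ m → 2 * √(m : ℝ) - 2 ≤ f m) : Tendsto f atTop atTop := by
  have hsqrt : Tendsto (fun m : ℕ => 2 * √(m : ℝ) - 2) atTop atTop :=
    tendsto_atTop_add_const_right _ _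
      ((Real.tendsto_sqrt_atTop.comp tendsto_natCast_atTop_atTop).const_mul_atTop two_pos)
  exact tendsto_natCast_atTop_iff.1
    (tendsto_atTop_mono' _ ((eventually_ge_atTop 2).mono hf) hsqrt)

section Classical

variable {k l n : ℕ} {Q : Matrix (Fin k) (Fin l) ℝ} {P : Matrix (Fin n) (Fin n) ℝ}

theorem ClassicallyGenerates.hasNonnegFactorization_left (hQ : ∀ i j, 0 ≤ Q i j)
    (h : ClassicallyGenerates Q P) : HasNonnegFactorization P k := by
  obtain ⟨A, B, hA, hB, hP⟩ := h
  refine ⟨fun i x => A x i, fun i y => ∑ j, B y j * Q i j, fun i x => hA.nonneg x i,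
    fun i y => Finset.sum_nonneg fun j _ => mul_nonneg (hB.nonneg y j) (hQ i j), fun x y => ?_⟩
  simp only [hP, Finset.mul_sum, mul_assoc]

theorem ClassicallyGenerates.hasNonnegFactorization_right (hQ : ∀ i j, 0 ≤ Q i j)
    (h : ClassicallyGenerates Q P) : HasNonnegFactorization P l := by
  obtain ⟨A, B, hA, hB, hP⟩ := h
  refine ⟨fun j x => ∑ i, A x i * Q i j, fun j y => B y j,
    fun j x => Finset.sum_nonneg fun i _ => mul_nonneg (hA.nonneg x i) (hQ i j),
    fun j y => hB.nonneg y j, fun x y => ?_⟩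
  rw [hP, Finset.sum_comm]
  simp only [Finset.sum_mul, mul_right_comm]

theorem clog_le_size (hk : n ≤ k) (hl : n ≤ l) : (Nat.clog 2 n : ℝ≥0∞) ≤ size k l := by
  rw [size, ENNReal.le_div_iff_mul_le (.inl two_ne_zero) (.inl ENNReal.ofNat_ne_top), mul_two]
  exact_mod_cast add_le_add (Nat.clog_mono_right 2 hk) (Nat.clog_mono_right 2 hl)

theorem clog_nonnegRank_le_classicalCost (P : Matrix (Fin n) (Fin n) ℝ) :
    (Nat.clog 2 (nonnegRank P) : ℝ≥0∞) ≤ classicalCost P :=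
  le_iInf fun _ => le_iInf fun _ => le_iInf fun _ => le_iInf fun h =>
    clog_le_size (h.2.hasNonnegFactorization_left h.1.nonneg).nonnegRank_le
      (h.2.hasNonnegFactorization_right h.1.nonneg).nonnegRank_le

end Classical

theorem Generates.quantumCost_le_size {a b n : ℕ} {lam : ℝ} {ρ : BiMatrix a b} (hρ : IsState ρ)
    {P : Matrix (Fin n) (Fin n) ℝ} (hP : Generates lam ρ P) : quantumCost lam P ≤ size a b :=
  iInf_le_of_le a <| iInf_le_of_le b <| iInf_le_of_le ρ <| iInf_le _ ⟨hρ, hP⟩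

theorem tendsto_quantumAdvantage_nhds_top {a b : ℕ} {lam : ℝ} {ρ : BiMatrix a b} (hρ : IsState ρ)
    {d : ℕ → ℕ} {P : (m : ℕ) → Matrix (Fin (d m)) (Fin (d m)) ℝ}
    (hP : ∀ m, Generates lam ρ (P m)) (hrank : Tendsto (fun m => nonnegRank (P m)) atTop atTop) :
    Tendsto (fun m => quantumAdvantage lam (P m)) atTop (𝓝 ∞) := by
  have hclog : Tendsto (Nat.clog 2) atTop atTop :=
    tendsto_atTop_atTop_of_monotone (Nat.clog_monotone 2)
      fun n => ⟨2 ^ n, (Nat.clog_pow 2 n one_lt_two).ge⟩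
  have hsize : size a b ≠ ∞ := ENNReal.div_ne_top (ENNReal.natCast_ne_top _) two_ne_zero
  have hlower : Tendsto (fun m => (Nat.clog 2 (nonnegRank (P m)) : ℝ≥0∞) / size a b) atTop
      (𝓝 ∞) := by
    rw [← ENNReal.top_div_of_ne_top hsize]
    exact ENNReal.Tendsto.div_const (ENNReal.tendsto_nat_nhds_top.comp (hclog.comp hrank))
      (.inl ENNReal.top_ne_zero)
  exact tendsto_nhds_top_mono' hlower fun m =>
    ENNReal.div_le_div (clog_nonnegRank_le_classicalCost _) ((hP m).quantumCost_le_size hρ)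

end Costs

end

end CorrGen

theorem theorem1 {a b : ℕ} (ψ : EuclideanSpace ℂ (Fin a × Fin b)) (hψ : ‖ψ‖ = 1)
    (hent : IsEntangled ψ) :
    ∃ P : (m : ℕ) → Matrix (Fin (m + 1)) (Fin (m + 1)) ℝ,
      (∀ m, 1 ≤ m → IsCorrelation (P m) ∧ Generates 0 (pureState ψ) (P m)) ∧
      Tendsto (fun m => quantumAdvantage 0 (P m)) atTop (𝓝 ∞) ∧
      ∃ p : ℝ, 0 < p ∧ p ≤ 1 ∧
        ∀ m, 2 ≤ m → ∃ α l r : Fin m → ℝ,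
          Function.Injective α ∧ (∀ x, 0 < l x) ∧ (∀ y, 0 < r y) ∧
          P m = addCorner (p • rescaledEdm α l r) (1 - p) ∧
          psdRank (edm α) = 2 ∧ psdRank (rescaledEdm α l r) = 2 ∧
          2 * √(m : ℝ) - 2 ≤ nonnegRank (edm α) ∧
          2 * √(m : ℝ) - 2 ≤ nonnegRank (rescaledEdm α l r) := by
  have hρ := isState_pureState hψ
  obtain ⟨p, hp, hp1, hgen⟩ := exists_generates_rescaledEdm hψ hent
  have hfam : ∀ m, ∃ P : Matrix (Fin (m + 1)) (Fin (m + 1)) ℝ, Generates 0 (pureState ψ) P ∧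
      (2 ≤ m → ∃ α l r : Fin m → ℝ, AlgebraicIndependent ℚ α ∧ (∀ x, 0 < l x) ∧ (∀ y, 0 < r y) ∧
        P = addCorner (p • rescaledEdm α l r) (1 - p)) := fun m => by
    by_cases hm : 2 ≤ m
    · obtain ⟨α, hα⟩ := exists_algebraicIndependent_real m
      obtain ⟨l, r, hl, hr, hP⟩ := hgen hm hα.injective
      exact ⟨_, hP, fun _ => ⟨α, l, r, hα, hl, hr, rfl⟩⟩
    · exact (hρ.exists_generates m).imp fun P hP => ⟨hP, fun h => absurd h hm⟩
  choose P hP hform using hfam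
  refine ⟨P, fun m _ => ⟨(hP m).isCorrelation hρ, hP m⟩,
    tendsto_quantumAdvantage_nhds_top hρ hP ?_, p, hp, hp1, fun m hm => ?_⟩
  · refine tendsto_atTop_of_two_mul_sqrt_sub_two_le fun m hm => ?_
    obtain ⟨α, l, r, hα, hl, hr, hPm⟩ := hform m hm
    have hnonneg := ((hP m).isCorrelation hρ).nonneg
    rw [hPm] at hnonneg ⊢
    exact two_mul_sqrt_sub_two_le_nonnegRank_addCorner hm hα hl hr hp hnonneg
  · obtain ⟨α, l, r, hα, hl, hr, hPm⟩ := hform m hm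
    exact ⟨α, l, r, hα.injective, hl, hr, hPm, psdRank_edm hm hα.injective,
      psdRank_rescaledEdm hm hα.injective hl hr, two_mul_sqrt_sub_two_le_nonnegRank_edm hm hα,
      two_mul_sqrt_sub_two_le_nonnegRank_rescaledEdm hm hα hl hr⟩
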